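/- **Theorem (Atkinson).** Let $m\in\mathbb N$, $x_0\in\mathbb R$, and let $Q:[x_0,\infty)\to\mathbb C^{m\times m}$ satisfy $Q(x)=Q(x)^*$ for a.e. $x\ge x_0$ and $Q\in L^1([x_0,c])^{m\times m}$ for all $c>x_0$. For $z\in\mathbb C$ let $$\Psi(z,x)=\begin{bmatrix}\Theta(z,x)&\Phi(z,x)\end{bmatrix}=\begin{bmatrix}\theta(z,x)&\phi(z,x)\\ \theta'(z,x)&\phi'(z,x)\end{bmatrix}$$ be the fundamental matrix of $-\psi''+Q\psi=z\psi$ on $[x_0,\infty)$ with $\Psi(z,x_0)=I_{2m}$; that is, $\Psi(z,\cdot)$ is absolutely continuous on every $[x_0,c]$ and, for a.e. $x>x_0$, $$J\Psi'=(zA+B(x))\Psi,\quad J=\begin{bmatrix}0&-I_m\\ I_m&0\end{bmatrix},\quad A=\begin{bmatrix}I_m&0\\0&0\end{bmatrix},\quad B(x)=\begin{bmatrix}-Q(x)&0\\0&I_m\end{bmatrix}.$$ Write $\Im(N)=(N-N^*)/(2i)$ for square matrices $N$. For $\Im z>0$ and $c>x_0$ let $D(z,c,x_0)$ be the set of all matrices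 $$M(z,c,x_0,\beta)=-\bigl(\beta\Phi(z,c)\bigr)^{-1}\bigl(\beta\Theta(z,c)\bigr),$$ where $\beta=[\beta_1\ \beta_2]$, $\beta_1,\beta_2\in\mathbb C^{m\times m}$, has rank $m$, satisfies $\Im(\beta_2\beta_1^*)>0$ or $\Im(\beta_2\beta_1^*)=0$, and $\beta\Phi(z,c)$ is nonsingular. The limit disk is $$D_+(z,x_0)=\bigcap_{c>x_0}\overline{D(z,c,x_0)}$$ (the limit point, if this set is a single matrix). Let $0<\varepsilon<\pi$ and let $C_\varepsilon=\{z\in\mathbb C:\ \Im z>0,\ |\arg z-\pi/2|<\varepsilon/2\}$ be the open sector in the upper half-plane with vertex $0$, symmetry axis the positive imaginary axis, and opening angle $\varepsilon$. For every $z\in C_\varepsilon$ let $M_+(z,x_0)$ be an arbitrary point of $D_+(z,x_0)$. Then $$M_+(z,x_0)=i z^{1/2}I_m+o(|z|^{1/2})\qquad\text{as } |z|\to\infty,\ z\in C_\varepsilon,$$ where $z^{1/2}$ is the square root with positive imaginary part; that is, $|z|^{-1/2}\,\|M_+(z,x_0)-iz^{1/2}I_m\|\to0$ as $|z|\to\infty$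 within $C_\varepsilon$. -/

import Mathlib

open scoped Matrix Matrix.Norms.L2Operator ComplexOrder

noncomputable section

namespace WeylTitchmarsh

/-- The standing hypothesis on the potential `Q : [x₀, ∞) → ℂ^{m × m}`: it is self-adjoint
almost everywhere on `[x₀, ∞)`, and its entries are in `L¹([x₀, c])` for every `c > x₀`. -/
structure IsPotential {m : ℕ} (Q : ℝ → Matrix (Fin m) (Fin m) ℂ) (x₀ : ℝ) : Prop where
  selfAdjoint : ∀ᵐ x ∂(MeasureTheory.volume.restrict (Set.Ici x₀)), (Q x)ᴴ = Q x
  integrable : ∀ c : ℝ, x₀ < c → ∀ i j : Fin m,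
    MeasureTheory.IntegrableOn (fun x => Q x i j) (Set.Icc x₀ c) MeasureTheory.volume

/-- The `2m × 2m` matrix `J = [[0, -I], [I, 0]]`. -/
def J (m : ℕ) : Matrix (Fin m ⊕ Fin m) (Fin m ⊕ Fin m) ℂ :=
  Matrix.fromBlocks 0 (-1) 1 0

/-- The `2m × 2m` matrix `A = [[I, 0], [0, 0]]`. -/
def A (m : ℕ) : Matrix (Fin m ⊕ Fin m) (Fin m ⊕ Fin m) ℂ :=
  Matrix.fromBlocks 1 0 0 0

/-- The `2m × 2m` matrix `B(x) = [[-Q(x), 0], [0, I]]`. -/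
def B {m : ℕ} (Q : ℝ → Matrix (Fin m) (Fin m) ℂ) (x : ℝ) :
    Matrix (Fin m ⊕ Fin m) (Fin m ⊕ Fin m) ℂ :=
  Matrix.fromBlocks (-Q x) 0 0 1

/-- `Ψ` is the fundamental matrix, normalized at `x₀`, of the first-order form
`J Ψ' = (z A + B(x)) Ψ` of the Schrödinger equation `-ψ'' + Q ψ = z ψ` on `[x₀, ∞)`: its entries
are absolutely continuous on every `[x₀, c]`, the equation holds almost everywhere, and
`Ψ(x₀) = I`.  The values of `Ψ` on `[x₀, ∞)` are uniquely determined by these conditions. -/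
structure IsFundamentalMatrix {m : ℕ} (Q : ℝ → Matrix (Fin m) (Fin m) ℂ) (z : ℂ) (x₀ : ℝ)
    (Ψ : ℝ → Matrix (Fin m ⊕ Fin m) (Fin m ⊕ Fin m) ℂ) : Prop where
  absolutelyContinuous : ∀ c : ℝ, x₀ < c → ∀ i j : Fin m ⊕ Fin m,
    AbsolutelyContinuousOnInterval (fun x => Ψ x i j) x₀ c
  equation : ∀ᵐ x ∂(MeasureTheory.volume.restrict (Set.Ioi x₀)),
    ∃ Ψ' : Matrix (Fin m ⊕ Fin m) (Fin m ⊕ Fin m) ℂ,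
      (∀ i j : Fin m ⊕ Fin m, HasDerivAt (fun t => Ψ t i j) (Ψ' i j) x) ∧
        J m * Ψ' = (z • A m + B Q x) * Ψ x
  initial : Ψ x₀ = 1

/-- The matrix imaginary part `Im(M) = (M - M*) / (2i)`. -/
def matIm {m : ℕ} (M : Matrix (Fin m) (Fin m) ℂ) : Matrix (Fin m) (Fin m) ℂ :=
  (1 / (2 * Complex.I)) • (M - Mᴴ)

/-- Boundary data `β = [β₁ β₂]` admissible for the nonreal spectral parameter `z`: `β` has rank
`m`, and `Im(β₂ β₁*)` is either zero or definite with the sign of `Im z`. For `Im z > 0` this says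
`Im(β₂ β₁*) = 0` or `Im(β₂ β₁*) > 0`. -/
def IsAdmissible {m : ℕ} (z : ℂ) (β : Matrix (Fin m) (Fin m ⊕ Fin m) ℂ) : Prop :=
  β.rank = m ∧
    (matIm (β.toCols₂ * (β.toCols₁)ᴴ) = 0 ∨
      (z.im • matIm (β.toCols₂ * (β.toCols₁)ᴴ)).PosDef)

/-- The set `D(z, c, x₀)` of all `M(z, c, x₀, β) = -(β Φ(z, c, x₀))⁻¹ (β Θ(z, c, x₀))`, with `β`
admissible and `β Φ(z, c, x₀)` nonsingular, where `Ψ = [Θ Φ]` is the normalized fundamental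
matrix. -/
def weylSet {m : ℕ} (Q : ℝ → Matrix (Fin m) (Fin m) ℂ) (z : ℂ) (c x₀ : ℝ) :
    Set (Matrix (Fin m) (Fin m) ℂ) :=
  {M | ∃ Ψ : ℝ → Matrix (Fin m ⊕ Fin m) (Fin m ⊕ Fin m) ℂ, IsFundamentalMatrix Q z x₀ Ψ ∧
    ∃ β : Matrix (Fin m) (Fin m ⊕ Fin m) ℂ, IsAdmissible z β ∧
      IsUnit (β * (Ψ c).toCols₂) ∧
      M = -((β * (Ψ c).toCols₂)⁻¹ * (β * (Ψ c).toCols₁))}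

/-- The limit disk `D₊(z, x₀)`: the limit, as `c → ∞`, of the nested (decreasing in `c`) closed
sets `closure D(z, c, x₀)`, that is, their intersection. If it is a single matrix, that matrix is
the limit point. -/
def limitDisk {m : ℕ} (Q : ℝ → Matrix (Fin m) (Fin m) ℂ) (z : ℂ) (x₀ : ℝ) :
    Set (Matrix (Fin m) (Fin m) ℂ) :=
  ⋂ c ∈ Set.Ioi x₀, closure (weylSet Q z c x₀)

/-- The open sector in the upper half-plane with vertex `0`, symmetry axis the positive imaginary
axis, and opening angle `ε`. -/
def sector (ε : ℝ) : Set ℂ :=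
  {z | 0 < z.im ∧ |z.arg - Real.pi / 2| < ε / 2}

end WeylTitchmarsh

end

/-!
Fix `c = x₀ + 1` and write `k = z^{1/2}`. For `M` in the Weyl set at `c` and a vector `v`, the
solution `y = θ v + φ M v` satisfies `y(x₀) = v`, `y'(x₀) = M v`, so that the claim is an estimate
of `r(x₀) = (M - i k) v`, where `r = y' - i k y` and `s = y' + i k y` are the amplitudes of the
growing and the decaying exponential. They satisfy `r' = -i k r + Q y` and `s' = i k s + Q y`.

The boundary condition at `c` gives `Im ⟨y, y'⟩ ≥ 0` there (`im_inner_nonneg_of_boundary`), and the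
Lagrange identity carries this inequality to all of `[x₀, c]` (`IsForcedSolution.im_inner_anti`).
Expressed through `r` and `s` it says `‖r‖ ≤ C ‖s‖`, with `C` depending only on the sector
(`norm_sub_le_mul_norm_add_of_im_inner_nonneg`); hence also `‖y‖ ≤ C' ‖s‖ / |k|`. Integrating the
equation of `s` forwards bounds `‖s‖` by `2 ‖s(x₀)‖` as soon as `|k|` is large compared with
`∫ ‖Q‖`, and integrating the equation of `r` backwards from `c` gives
`‖r(x₀)‖ ≤ δ ‖s(x₀)‖` with `δ = O(e^{-ρ |k|} + |k|⁻¹)`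
(`IsForcedSolution.norm_sub_le_mul_norm_add`). As `s(x₀) = r(x₀) + 2 i k v`, this means
`‖M - i k‖ ≤ 4 δ |k|`, uniformly on the Weyl set and therefore on its closure, which contains the
limit disk.
-/

open Set MeasureTheory Filter

/-! ### Absolutely continuous functions -/

theorem LipschitzWith.comp_absolutelyContinuousOnInterval {X Y : Type*} [PseudoMetricSpace X]
    [PseudoMetricSpace Y] {K : NNReal} {φ : X → Y} (hφ : LipschitzWith K φ) {f : ℝ → X} {a b : ℝ}
    (hf : AbsolutelyContinuousOnInterval f a b) :
    AbsolutelyContinuousOnInterval (fun x => φ (f x)) a b := by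
  have h : Tendsto (fun E : ℕ × (ℕ → ℝ × ℝ) =>
      (K : ℝ) * ∑ i ∈ Finset.range E.1, dist (f (E.2 i).1) (f (E.2 i).2))
      (AbsolutelyContinuousOnInterval.totalLengthFilter ⊓
        𝓟 (AbsolutelyContinuousOnInterval.disjWithin a b)) (nhds 0) := by
    simpa using Tendsto.const_mul (K : ℝ) hf
  refine squeeze_zero (fun E => Finset.sum_nonneg fun i _ => dist_nonneg) (fun E => ?_) h
  rw [Finset.mul_sum]
  exact Finset.sum_le_sum fun i _ => hφ.dist_le_mul _ _

theorem AbsolutelyContinuousOnInterval.finset_sum {ι F : Type*} [NormedAddCommGroup F]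
    {f : ι → ℝ → F} {a b : ℝ} (t : Finset ι)
    (hf : ∀ i ∈ t, AbsolutelyContinuousOnInterval (f i) a b) :
    AbsolutelyContinuousOnInterval (fun x => ∑ i ∈ t, f i x) a b := by
  classical
  induction t using Finset.induction_on with
  | empty =>
    simpa using (LipschitzWith.const (0 : F)).comp_absolutelyContinuousOnInterval
      (LipschitzOnWith.absolutelyContinuousOnInterval
        (LipschitzWith.id.lipschitzOnWith (s := uIcc a b)))
  | insert i t hi ih =>
    simp only [Finset.sum_insert hi]
    exact (hf i (Finset.mem_insert_self i t)).add
      (ih fun j hj => hf j (Finset.mem_insert_of_mem hj))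

theorem AbsolutelyContinuousOnInterval.le_of_ae_hasDerivAt_nonpos {f f' : ℝ → ℝ} {a b : ℝ}
    (hab : a ≤ b) (hf : AbsolutelyContinuousOnInterval f a b)
    (hd : ∀ᵐ x, x ∈ Ioc a b → HasDerivAt f (f' x) x ∧ f' x ≤ 0) : f b ≤ f a := by
  have h := hf.integral_deriv_eq_sub
  have h2 : ∫ x in a..b, deriv f x ≤ 0 := by
    rw [intervalIntegral.integral_of_le hab]
    apply integral_nonpos_of_ae
    rw [EventuallyLE, ae_restrict_iff' measurableSet_Ioc]
    filter_upwards [hd] with x hx hxm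
    rw [(hx hxm).1.deriv]
    exact (hx hxm).2
  linarith

/-- The mean value inequality for an absolutely continuous function with values in a normed space,
reduced to real-valued functions by a norming functional. -/
theorem AbsolutelyContinuousOnInterval.norm_sub_le_integral {F : Type*} [NormedAddCommGroup F]
    [NormedSpace ℝ F] {f f' : ℝ → F} {g : ℝ → ℝ} {a b : ℝ} (hab : a ≤ b)
    (hf : AbsolutelyContinuousOnInterval f a b) (hg : IntervalIntegrable g volume a b)
    (hd : ∀ᵐ x, x ∈ Ioc a b → HasDerivAt f (f' x) x ∧ ‖f' x‖ ≤ g x) :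
    ‖f b - f a‖ ≤ ∫ x in a..b, g x := by
  obtain ⟨φ, hφ, hφv⟩ := exists_dual_vector'' ℝ (f b - f a)
  have hac := φ.lipschitz.comp_absolutelyContinuousOnInterval hf
  have h := hac.integral_deriv_eq_sub
  have h2 : ∫ x in a..b, deriv (fun x => φ (f x)) x ≤ ∫ x in a..b, g x := by
    rw [intervalIntegral.integral_of_le hab, intervalIntegral.integral_of_le hab]
    refine integral_mono_ae hac.intervalIntegrable_deriv.1 hg.1 ?_
    rw [EventuallyLE, ae_restrict_iff' measurableSet_Ioc]
    filter_upwards [hd] with x hx hxm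
    obtain ⟨h1, h2⟩ := hx hxm
    have h3 : HasDerivAt (fun x => φ (f x)) (φ (f' x)) x := φ.hasFDerivAt.comp_hasDerivAt x h1
    rw [h3.deriv]
    calc φ (f' x) ≤ ‖φ (f' x)‖ := Real.le_norm_self _
      _ ≤ ‖φ‖ * ‖f' x‖ := φ.le_opNorm _
      _ ≤ 1 * ‖f' x‖ := by gcongr
      _ ≤ g x := by rw [one_mul]; exact h2
  rw [map_sub] at hφv
  have h4 : φ (f b) - φ (f a) = ‖f b - f a‖ := by simpa using hφv
  linarith

/-! ### The Hermitian form `Im ⟨a, b⟩` -/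

section

variable {E : Type*} [NormedAddCommGroup E] [InnerProductSpace ℂ E]

theorem im_inner_eq_norm_sq_sub_norm_sq (a b : E) :
    (inner ℂ a b).im = (‖a - Complex.I • b‖ ^ 2 - ‖a + Complex.I • b‖ ^ 2) / 4 := by
  rw [@norm_sub_sq ℂ, @norm_add_sq ℂ, inner_smul_right]
  simp
  ring

/-- The imaginary part of the inner product of absolutely continuous curves is absolutely
continuous, by polarization. -/
theorem AbsolutelyContinuousOnInterval.im_inner {y p : ℝ → E} {a b : ℝ}
    (hy : AbsolutelyContinuousOnInterval y a b) (hp : AbsolutelyContinuousOnInterval p a b) :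
    AbsolutelyContinuousOnInterval (fun x => (inner ℂ (y x) (p x)).im) a b := by
  have hsq : ∀ f : ℝ → E, AbsolutelyContinuousOnInterval f a b →
      AbsolutelyContinuousOnInterval (fun x => ‖f x‖ ^ 2) a b := by
    intro f hf
    have := lipschitzWith_one_norm.comp_absolutelyContinuousOnInterval hf
    simpa only [sq] using this.fun_mul this
  have h1 := hsq _ (hy.sub (hp.const_smul Complex.I))
  have h2 := hsq _ (hy.add (hp.const_smul Complex.I))
  have h3 := (h1.sub h2).const_mul (1 / 4)
  convert h3 using 1
  ext x
  simp only [im_inner_eq_norm_sq_sub_norm_sq, Pi.sub_apply, Pi.add_apply]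
  ring

/-- Let the row space of `[b₁ b₂]` be nonpositive for the Hermitian form `Im ⟨a, b⟩` on `E × E`,
and let it have full dimension. Then its orthogonal complement, the kernel of `[b₁ b₂]`, is
nonnegative for this form. -/
theorem im_inner_nonneg_of_boundary [FiniteDimensional ℂ E] (b₁ b₂ : E →L[ℂ] E)
    (hpos : ∀ u, 0 ≤ (inner ℂ (b₂.adjoint u) (b₁.adjoint u)).im)
    (hinj : ∀ u, b₁.adjoint u = 0 → b₂.adjoint u = 0 → u = 0)
    {a b : E} (h : b₁ a + b₂ b = 0) : 0 ≤ (inner ℂ a b).im := by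
  -- `b₁* + i b₂*` is bijective; the preimage `u` of `a + i b` gives a vector `(b₁* u, b₂* u)`
  -- orthogonal to `(a, b)`, which reduces the claim to the Cauchy-Schwarz inequality.
  have hY : Function.Injective (b₁.adjoint + Complex.I • b₂.adjoint : E →L[ℂ] E) := by
    rw [injective_iff_map_eq_zero]
    intro u hu
    have h1 : b₁.adjoint u = -(Complex.I • b₂.adjoint u) := eq_neg_of_add_eq_zero_left hu
    have h2 := hpos u
    rw [h1, inner_neg_right, inner_smul_right, inner_self_eq_norm_sq_to_K] at h2
    have h3 : b₂.adjoint u = 0 := by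
      have : ‖b₂.adjoint u‖ ^ 2 ≤ 0 := by
        have := h2
        simp [← Complex.ofReal_pow] at this
        simp [this]
      exact norm_eq_zero.1 (pow_eq_zero_iff two_ne_zero |>.1 (le_antisymm this (by positivity)))
    exact hinj u (by rw [h1, h3]; simp) h3
  obtain ⟨u, hu⟩ := (LinearMap.injective_iff_surjective
    (f := (b₁.adjoint + Complex.I • b₂.adjoint : E →L[ℂ] E).toLinearMap)).1 hY
      (a + Complex.I • b)
  have hu' : b₁.adjoint u + Complex.I • b₂.adjoint u = a + Complex.I • b := hu
  have horth : inner ℂ (b₁.adjoint u) a + inner ℂ (b₂.adjoint u) b = 0 := by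
    rw [ContinuousLinearMap.adjoint_inner_left, ContinuousLinearMap.adjoint_inner_left,
      ← inner_add_right, h, inner_zero_right]
  have h4 : ‖b₁.adjoint u - Complex.I • b₂.adjoint u‖ ^ 2 ≤ ‖a + Complex.I • b‖ ^ 2 := by
    have h5 := im_inner_eq_norm_sq_sub_norm_sq (b₁.adjoint u) (b₂.adjoint u)
    have h6 := hpos u
    rw [← inner_conj_symm, Complex.conj_im] at h6
    rw [hu'] at h5
    linarith
  have h5 : inner ℂ (b₁.adjoint u + Complex.I • b₂.adjoint u) (a + Complex.I • b) =
      -inner ℂ (b₁.adjoint u - Complex.I • b₂.adjoint u) (a - Complex.I • b) := by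
    simp only [inner_add_left, inner_add_right, inner_sub_left, inner_sub_right, inner_smul_left,
      inner_smul_right, Complex.conj_I]
    have hI := Complex.I_mul_I
    linear_combination 2 * horth - 2 * inner ℂ (b₂.adjoint u) b * hI
  rw [hu'] at h5
  have h6 : ‖a + Complex.I • b‖ ^ 2 ≤ ‖a + Complex.I • b‖ * ‖a - Complex.I • b‖ := by
    have h7 := congrArg norm h5
    rw [inner_self_eq_norm_sq_to_K, norm_neg] at h7
    simp only [norm_pow, Complex.coe_algebraMap, Complex.norm_real, norm_norm] at h7
    rw [h7]
    refine (norm_inner_le_norm _ _).trans ?_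
    gcongr
    exact (sq_le_sq₀ (norm_nonneg _) (norm_nonneg _)).1 h4
  rw [im_inner_eq_norm_sq_sub_norm_sq]
  have h8 := norm_nonneg (a + Complex.I • b)
  have h9 := norm_nonneg (a - Complex.I • b)
  have : ‖a + Complex.I • b‖ ≤ ‖a - Complex.I • b‖ := by
    by_contra hc
    nlinarith
  nlinarith

end

/-! ### Solutions of the forced equation -/

section

variable {E : Type*} [NormedAddCommGroup E] [InnerProductSpace ℂ E]

/-- In terms of the amplitudes `r = p - i k y` and `s = p + i k y` of the growing and the decaying
exponential, nonnegativity of `Im ⟨y, p⟩` makes `r` dominated by `s`, for `k` inside the first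
quadrant. -/
theorem norm_sub_le_mul_norm_add_of_im_inner_nonneg {k : ℂ} {ρ : ℝ} (hρ : 0 < ρ)
    (hk : 0 < ‖k‖) (hre : ρ * ‖k‖ ≤ k.re) {y p : E} (h : 0 ≤ (inner ℂ y p).im) :
    ‖p - (Complex.I * k) • y‖ ≤ (1 + 2 / ρ) * ‖p + (Complex.I * k) • y‖ := by
  set r := p - (Complex.I * k) • y with hr
  set s := p + (Complex.I * k) • y with hs
  have h1 : k.re * (‖s‖ ^ 2 - ‖r‖ ^ 2) - 2 * k.im * (inner ℂ s r).im =
      4 * ‖k‖ ^ 2 * (inner ℂ y p).im := by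
    have e1 := @norm_add_sq ℂ _ _ _ _ p ((Complex.I * k) • y)
    have e2 := @norm_sub_sq ℂ _ _ _ _ p ((Complex.I * k) • y)
    have e3 : (inner ℂ s r).im = -2 * (inner ℂ p ((Complex.I * k) • y)).im := by
      have h0 : (inner ℂ ((Complex.I * k) • y) p).im =
          -(inner ℂ p ((Complex.I * k) • y)).im := by
        rw [← inner_conj_symm, Complex.conj_im]
      have hp : (inner ℂ p p : ℂ).im = 0 := inner_self_im (𝕜 := ℂ) p
      have hq : (inner ℂ ((Complex.I * k) • y) ((Complex.I * k) • y) : ℂ).im = 0 :=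
        inner_self_im (𝕜 := ℂ) _
      rw [hr, hs, inner_add_left, inner_sub_right, inner_sub_right]
      simp only [Complex.add_im, Complex.sub_im, hp, hq, h0]
      ring
    rw [← hs] at e1
    rw [← hr] at e2
    rw [e1, e2, e3, inner_smul_right]
    have e4 : (inner ℂ p y).re = (inner ℂ y p).re := by
      rw [← inner_conj_symm, Complex.conj_re]
    have e5 : (inner ℂ p y).im = -(inner ℂ y p).im := by
      rw [← inner_conj_symm, Complex.conj_im]
    have e6 : ‖k‖ ^ 2 = k.re ^ 2 + k.im ^ 2 := by
      rw [Complex.sq_norm, Complex.normSq_apply]; ring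
    rw [e6]
    simp only [Complex.mul_re, Complex.mul_im, Complex.I_re, Complex.I_im, e4, e5,
      RCLike.re_to_complex]
    ring
  have h2 : |(inner ℂ s r).im| ≤ ‖s‖ * ‖r‖ :=
    (Complex.abs_im_le_norm _).trans (norm_inner_le_norm _ _)
  have h3 : |k.im| ≤ ‖k‖ := Complex.abs_im_le_norm k
  have h4 : -(2 * k.im * (inner ℂ s r).im) ≤ 2 * ‖k‖ * (‖s‖ * ‖r‖) := by
    have : |k.im * (inner ℂ s r).im| ≤ ‖k‖ * (‖s‖ * ‖r‖) := by
      rw [abs_mul]; gcongr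
    have := neg_abs_le (k.im * (inner ℂ s r).im)
    linarith
  have h5 : 0 ≤ 4 * ‖k‖ ^ 2 * (inner ℂ y p).im := by positivity
  by_contra! hc
  have hS : 0 ≤ ‖s‖ := norm_nonneg _
  have hτ : 0 < 2 / ρ := by positivity
  have h6 : ‖s‖ < ‖r‖ := by nlinarith
  have h7 : ‖s‖ ^ 2 + 2 / ρ * (‖s‖ * ‖r‖) < ‖r‖ ^ 2 := by
    have : (1 + 2 / ρ) * ‖s‖ * ‖r‖ < ‖r‖ * ‖r‖ :=
      mul_lt_mul_of_pos_right hc (lt_of_le_of_lt hS h6)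
    nlinarith
  have h8 : 0 < k.re := lt_of_lt_of_le (by positivity) hre
  have h9 : k.re * (2 / ρ * (‖s‖ * ‖r‖)) < k.re * (‖r‖ ^ 2 - ‖s‖ ^ 2) :=
    mul_lt_mul_of_pos_left (by linarith) h8
  have h10 : 2 * ‖k‖ * (‖s‖ * ‖r‖) ≤ k.re * (2 / ρ * (‖s‖ * ‖r‖)) := by
    have : 2 * ‖k‖ ≤ k.re * (2 / ρ) := by
      calc 2 * ‖k‖ = (ρ * ‖k‖) * (2 / ρ) := by field_simp
        _ ≤ _ := by gcongr
    calc _ ≤ k.re * (2 / ρ) * (‖s‖ * ‖r‖) := by gcongr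
      _ = _ := by ring
  linarith

theorem norm_exp_I_mul_sub (k : ℂ) (x c : ℝ) :
    ‖Complex.exp (Complex.I * k * ((x : ℂ) - c))‖ = Real.exp (-(k.im * (x - c))) := by
  rw [Complex.norm_exp]
  congr 1
  simp [Complex.mul_re]

/-- Data of a solution `y`, `p = y'` of `y'' = h - k² y` on `[a, b]`, where the forcing term `h`
is bounded by `q ‖y‖`. For the Schrödinger equation `h = Q y` and `q` dominates `‖Q‖`. -/
structure IsForcedSolution (y p h : ℝ → E) (q : ℝ → ℝ) (k : ℂ) (a b : ℝ) : Prop where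
  absolutelyContinuous_fst : AbsolutelyContinuousOnInterval y a b
  absolutelyContinuous_snd : AbsolutelyContinuousOnInterval p a b
  integrable : IntervalIntegrable q volume a b
  nonneg : ∀ x, 0 ≤ q x
  equation : ∀ᵐ x, x ∈ Ioc a b → HasDerivAt y (p x) x ∧ HasDerivAt p (h x - k ^ 2 • y x) x ∧
    ‖h x‖ ≤ q x * ‖y x‖

namespace IsForcedSolution

variable {y p h : ℝ → E} {q : ℝ → ℝ} {k : ℂ} {a b : ℝ}

theorem mono (H : IsForcedSolution y p h q k a b) {c d : ℝ} (hac : a ≤ c) (hcd : c ≤ d)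
    (hdb : d ≤ b) : IsForcedSolution y p h q k c d := by
  have hsub : uIcc c d ⊆ uIcc a b := by
    rw [uIcc_of_le hcd, uIcc_of_le (hac.trans (hcd.trans hdb))]
    exact Icc_subset_Icc hac hdb
  refine ⟨H.1.mono hsub, H.2.mono hsub, H.3.mono_set hsub, H.4, ?_⟩
  filter_upwards [H.5] with x hx hxm
  exact hx (Ioc_subset_Ioc hac hdb hxm)

/-- The Lagrange identity: for a self-adjoint potential `Im ⟨y, y'⟩` does not increase, since its
derivative is `-Im k² ‖y‖²`. -/
theorem im_inner_anti (H : IsForcedSolution y p h q k a b) (hab : a ≤ b)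
    (hk : 0 ≤ (k ^ 2).im) (hh : ∀ᵐ x, x ∈ Ioc a b → (inner ℂ (y x) (h x)).im = 0) :
    (inner ℂ (y b) (p b)).im ≤ (inner ℂ (y a) (p a)).im := by
  refine (H.1.im_inner H.2).le_of_ae_hasDerivAt_nonpos hab
    (f' := fun x => -((k ^ 2).im * ‖y x‖ ^ 2)) ?_
  filter_upwards [H.5, hh] with x hx hhx hxm
  obtain ⟨h1, h2, -⟩ := hx hxm
  refine ⟨?_, by have := mul_nonneg hk (sq_nonneg ‖y x‖); linarith⟩
  have h3 := Complex.imCLM.hasFDerivAt.comp_hasDerivAt x (h1.inner ℂ h2)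
  have h4 : (inner ℂ (y x) (h x - k ^ 2 • y x) + inner ℂ (p x) (p x)).im =
      -((k ^ 2).im * ‖y x‖ ^ 2) := by
    rw [inner_sub_right, inner_smul_right, inner_self_eq_norm_sq_to_K, inner_self_eq_norm_sq_to_K]
    have := hhx hxm
    simp only [Complex.coe_algebraMap, ← Complex.ofReal_pow, Complex.add_im, Complex.sub_im,
      Complex.im_mul_ofReal, Complex.ofReal_im, this]
    ring
  rw [← h4]
  exact h3

/-- The variation of constants estimate for `p - i σ y`, `σ = ± k`, which solves
`f' = -i σ f + h`. The reference point `c` normalizes the exponential factor. -/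
theorem norm_sub_le (H : IsForcedSolution y p h q k a b) (hab : a ≤ b) {σ : ℂ}
    (hσ : σ ^ 2 = k ^ 2) (c : ℝ) (hc : ∀ x ∈ Icc a b, 0 ≤ σ.im * (x - c)) {Y : ℝ}
    (hY : ∀ x ∈ Icc a b, ‖y x‖ ≤ Y) :
    ‖Complex.exp (Complex.I * σ * ((b : ℂ) - c)) • (p b - (Complex.I * σ) • y b) -
      Complex.exp (Complex.I * σ * ((a : ℂ) - c)) • (p a - (Complex.I * σ) • y a)‖ ≤
      (∫ x in a..b, q x) * Y := by
  have hexp : ∀ x : ℝ, HasDerivAt (fun x : ℝ => Complex.exp (Complex.I * σ * ((x : ℂ) - c)))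
      (Complex.exp (Complex.I * σ * ((x : ℂ) - c)) * (Complex.I * σ)) x := by
    intro x
    have h1 : HasDerivAt (fun x : ℝ => Complex.I * σ * ((x : ℂ) - c)) (Complex.I * σ) x := by
      simpa using ((Complex.ofRealCLM.hasDerivAt (x := x)).sub_const (c : ℂ)).const_mul
        (Complex.I * σ)
    exact h1.cexp
  have hexpac : AbsolutelyContinuousOnInterval
      (fun x : ℝ => Complex.exp (Complex.I * σ * ((x : ℂ) - c))) a b := by
    apply ContDiffOn.absolutelyContinuousOnInterval
    apply ContDiff.contDiffOn
    have : ContDiff ℝ 1 (fun x : ℝ => (x : ℂ)) := Complex.ofRealCLM.contDiff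
    fun_prop
  have hac : AbsolutelyContinuousOnInterval (fun x : ℝ =>
      Complex.exp (Complex.I * σ * ((x : ℂ) - c)) • (p x - (Complex.I * σ) • y x)) a b :=
    hexpac.smul (H.2.sub (H.1.const_smul (Complex.I * σ)))
  rw [← intervalIntegral.integral_mul_const]
  refine hac.norm_sub_le_integral hab (H.3.mul_const Y)
    (f' := fun x => Complex.exp (Complex.I * σ * ((x : ℂ) - c)) • h x) ?_
  filter_upwards [H.5] with x hx hxm
  obtain ⟨h1, h2, h3⟩ := hx hxm
  constructor
  · have h4 := (hexp x).smul (h2.sub (h1.const_smul (Complex.I * σ)))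
    refine h4.congr_deriv ?_
    rw [← hσ]
    have hI : Complex.I ^ 2 = -1 := Complex.I_sq
    simp only [Pi.sub_apply, Pi.smul_apply]
    match_scalars
    · ring
    · ring_nf
      rw [hI]
      ring
    · ring
  · have hxi := Ioc_subset_Icc_self hxm
    rw [norm_smul, norm_exp_I_mul_sub]
    have h5 : Real.exp (-(σ.im * (x - c))) ≤ 1 := Real.exp_le_one_iff.2 (by linarith [hc x hxi])
    have h6 := H.nonneg x
    calc _ ≤ 1 * (q x * ‖y x‖) := by gcongr
      _ ≤ q x * Y := by rw [one_mul]; gcongr; exact hY x hxi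

/-- A solution on `[a, b]` with `Im ⟨y, y'⟩ ≥ 0` is close to a decaying exponential at `a`: the
amplitude `p - i k y` of the growing one is small compared to that of the decaying one. -/
theorem norm_sub_le_mul_norm_add (H : IsForcedSolution y p h q k a b) (hab : a ≤ b)
    {ρ : ℝ} (hρ : 0 < ρ) (hk : 0 < ‖k‖) (hre : ρ * ‖k‖ ≤ k.re) (him : ρ * ‖k‖ ≤ k.im)
    (hpos : ∀ x ∈ Icc a b, 0 ≤ (inner ℂ (y x) (p x)).im)
    (hsmall : (1 + 1 / ρ) / ‖k‖ * (∫ x in a..b, q x) ≤ 1 / 2) :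
    ‖p a - (Complex.I * k) • y a‖ ≤
      2 * (Real.exp (-(ρ * ‖k‖ * (b - a))) * (1 + 2 / ρ) +
        (1 + 1 / ρ) / ‖k‖ * ∫ x in a..b, q x) * ‖p a + (Complex.I * k) • y a‖ := by
  have hkim : 0 < k.im := lt_of_lt_of_le (by positivity) him
  set s : ℝ → E := fun x => p x + (Complex.I * k) • y x with hs
  have hrs : ∀ x ∈ Icc a b, ‖p x - (Complex.I * k) • y x‖ ≤ (1 + 2 / ρ) * ‖s x‖ := fun x hx =>
    norm_sub_le_mul_norm_add_of_im_inner_nonneg hρ hk hre (hpos x hx)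
  have hys : ∀ x ∈ Icc a b, ‖y x‖ ≤ (1 + 1 / ρ) / ‖k‖ * ‖s x‖ := by
    intro x hx
    have h1 : (2 * (Complex.I * k)) • y x = s x - (p x - (Complex.I * k) • y x) := by
      rw [hs]; module
    have h2 : 2 * ‖k‖ * ‖y x‖ ≤ ‖s x‖ + (1 + 2 / ρ) * ‖s x‖ := by
      have h3 := congrArg norm h1
      rw [norm_smul] at h3
      simp only [norm_mul, Complex.norm_ofNat, Complex.norm_I, one_mul] at h3
      rw [h3]
      exact (_root_.norm_sub_le _ _).trans (by gcongr; exact hrs x hx)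
    rw [div_mul_eq_mul_div, le_div_iff₀ hk]
    have h4 : 2 / ρ = 2 * (1 / ρ) := by ring
    rw [h4] at h2
    nlinarith
  have hcont : ContinuousOn s (Icc a b) := by
    have h1 := H.1.continuousOn
    have h2 := H.2.continuousOn
    rw [uIcc_of_le hab] at h1 h2
    exact h2.add (h1.const_smul _)
  obtain ⟨m, hm, hmax⟩ := isCompact_Icc.exists_isMaxOn (nonempty_Icc.2 hab) hcont.norm
  set Y := (1 + 1 / ρ) / ‖k‖ * ‖s m‖ with hYdef
  have hY : ∀ x ∈ Icc a b, ‖y x‖ ≤ Y := fun x hx =>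
    (hys x hx).trans (by rw [hYdef]; gcongr; exact hmax hx)
  have hY0 : 0 ≤ Y := by positivity
  -- The maximum of `‖s‖` is at most twice its initial value.
  have hsm : ‖s m‖ ≤ 2 * ‖s a‖ := by
    -- The factor `e^{-i k (x - m)}` has norm at most `1` to the left of the maximum point `m`.
    have h1 := (H.mono le_rfl hm.1 hm.2).norm_sub_le hm.1 (σ := -k) (by ring) m
      (fun x hx => by rw [Complex.neg_im]; nlinarith [hx.2])
      (fun x hx => hY x (Icc_subset_Icc_right hm.2 hx))
    have h2 : ∫ x in a..m, q x ≤ ∫ x in a..b, q x :=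
      intervalIntegral.integral_mono_interval le_rfl hm.1 hm.2
        (Eventually.of_forall H.nonneg) H.integrable
    simp only [mul_neg, neg_smul, sub_neg_eq_add, sub_self, mul_zero,
      Complex.exp_zero, one_smul] at h1
    change ‖s m - _ • s a‖ ≤ _ at h1
    have h3 : ‖Complex.exp (-(Complex.I * k) * ((a : ℂ) - m)) • s a‖ ≤ ‖s a‖ := by
      have := norm_exp_I_mul_sub (-k) a m
      rw [mul_neg] at this
      rw [norm_smul, this]
      refine mul_le_of_le_one_left (norm_nonneg _) (Real.exp_le_one_iff.2 ?_)
      rw [Complex.neg_im]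
      nlinarith [hm.1]
    have h4 := norm_sub_norm_le (s m) (Complex.exp (-(Complex.I * k) * ((a : ℂ) - m)) • s a)
    have h5 : (∫ x in a..m, q x) * Y ≤ 1 / 2 * ‖s m‖ := by
      calc _ ≤ (∫ x in a..b, q x) * Y := by gcongr
        _ = ((1 + 1 / ρ) / ‖k‖ * ∫ x in a..b, q x) * ‖s m‖ := by rw [hYdef]; ring
        _ ≤ _ := by gcongr
    linarith
  -- For the growing amplitude the factor `e^{i k (x - a)}` makes the contribution of `b` small.
  have h1 := H.norm_sub_le hab rfl a (fun x hx => mul_nonneg hkim.le (by linarith [hx.1])) hY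
  simp only [sub_self, mul_zero, Complex.exp_zero, one_smul] at h1
  rw [norm_sub_rev] at h1
  have h2 := norm_sub_norm_le (p a - (Complex.I * k) • y a)
    (Complex.exp (Complex.I * k * ((b : ℂ) - a)) • (p b - (Complex.I * k) • y b))
  have h3 : ‖Complex.exp (Complex.I * k * ((b : ℂ) - a)) • (p b - (Complex.I * k) • y b)‖ ≤
      Real.exp (-(ρ * ‖k‖ * (b - a))) * ((1 + 2 / ρ) * ‖s m‖) := by
    rw [norm_smul, norm_exp_I_mul_sub]
    have hb := right_mem_Icc.2 hab
    have h5 : ‖s b‖ ≤ ‖s m‖ := hmax hb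
    have h6 : 0 ≤ b - a := sub_nonneg.2 hab
    gcongr
    exact (hrs b hb).trans (by gcongr)
  have hI : 0 ≤ ∫ x in a..b, q x := intervalIntegral.integral_nonneg hab fun x _ => H.nonneg x
  calc _ ≤ (Real.exp (-(ρ * ‖k‖ * (b - a))) * (1 + 2 / ρ) +
        (1 + 1 / ρ) / ‖k‖ * ∫ x in a..b, q x) * ‖s m‖ := by
        rw [hYdef] at h1
        linarith
    _ ≤ (Real.exp (-(ρ * ‖k‖ * (b - a))) * (1 + 2 / ρ) +
        (1 + 1 / ρ) / ‖k‖ * ∫ x in a..b, q x) * (2 * ‖s a‖) := by gcongr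
    _ = _ := by ring

end IsForcedSolution
end

/-! ### Curves in Euclidean space -/

theorem EuclideanSpace.absolutelyContinuousOnInterval {n : Type*} [Fintype n]
    {f : ℝ → EuclideanSpace ℂ n} {a b : ℝ}
    (hf : ∀ i, AbsolutelyContinuousOnInterval (fun x => f x i) a b) :
    AbsolutelyContinuousOnInterval f a b := by
  have h : ∀ i, AbsolutelyContinuousOnInterval
      (fun x => f x i • EuclideanSpace.basisFun n ℂ i) a b := fun i =>
    ((ContinuousLinearMap.id ℂ ℂ).smulRight
      (EuclideanSpace.basisFun n ℂ i)).lipschitz.comp_absolutelyContinuousOnInterval (hf i)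
  have hf' : f = fun x => ∑ i, f x i • EuclideanSpace.basisFun n ℂ i :=
    funext fun x => ((EuclideanSpace.basisFun n ℂ).sum_repr (f x)).symm
  rw [hf']
  exact AbsolutelyContinuousOnInterval.finset_sum Finset.univ fun i _ => h i

theorem EuclideanSpace.hasDerivAt_of_forall {n : Type*} [Fintype n]
    {f : ℝ → EuclideanSpace ℂ n} {f' : EuclideanSpace ℂ n} {x : ℝ}
    (hf : ∀ i, HasDerivAt (fun t => f t i) (f' i) x) : HasDerivAt f f' x := by
  have h := (PiLp.continuousLinearEquiv 2 ℝ (fun _ : n => ℂ)).symm.hasFDerivAt.comp_hasDerivAt x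
    (hasDerivAt_pi.2 hf)
  exact h

theorem EuclideanSpace.norm_toLp_mulVec_le {n : Type*} [Fintype n] (T : Matrix n n ℂ)
    (y : EuclideanSpace ℂ n) :
    ‖(WithLp.toLp 2 (T *ᵥ y.ofLp) : EuclideanSpace ℂ n)‖ ≤ (∑ i, ∑ j, ‖T i j‖) * ‖y‖ := by
  rw [← (EuclideanSpace.basisFun n ℂ).sum_repr (WithLp.toLp 2 (T *ᵥ y.ofLp)), Finset.sum_mul]
  refine (norm_sum_le _ _).trans (Finset.sum_le_sum fun i _ => ?_)
  rw [norm_smul, OrthonormalBasis.norm_eq_one, mul_one, EuclideanSpace.basisFun_repr,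
    Finset.sum_mul]
  refine (norm_sum_le _ _).trans (Finset.sum_le_sum fun j _ => ?_)
  rw [norm_mul]
  gcongr
  exact PiLp.norm_apply_le y j

/-! ### The Weyl set at a finite endpoint -/

namespace WeylTitchmarsh

variable {m : ℕ}

theorem inner_matIm (N : Matrix (Fin m) (Fin m) ℂ) (u : EuclideanSpace ℂ (Fin m)) :
    inner ℂ u (Matrix.toEuclideanCLM (𝕜 := ℂ) (matIm N) u) =
      ((inner ℂ u (Matrix.toEuclideanCLM (𝕜 := ℂ) N u)).im : ℂ) := by
  have h : inner ℂ u (Matrix.toEuclideanCLM (𝕜 := ℂ) Nᴴ u) =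
      star (inner ℂ u (Matrix.toEuclideanCLM (𝕜 := ℂ) N u)) := by
    rw [← Matrix.star_eq_conjTranspose, map_star, ContinuousLinearMap.star_eq_adjoint,
      ContinuousLinearMap.adjoint_inner_right]
    exact (inner_conj_symm _ _).symm
  rw [matIm, map_smul, map_sub, smul_apply, sub_apply,
    inner_smul_right, inner_sub_right, h, Complex.star_def, Complex.sub_conj]
  have := Complex.I_ne_zero
  push_cast
  field_simp

theorem adjoint_toEuclideanCLM (N : Matrix (Fin m) (Fin m) ℂ) :
    (Matrix.toEuclideanCLM (𝕜 := ℂ) N).adjoint = Matrix.toEuclideanCLM (𝕜 := ℂ) Nᴴ := by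
  rw [← ContinuousLinearMap.star_eq_adjoint, ← map_star, Matrix.star_eq_conjTranspose]

/-- Vectors annihilated by an admissible `β` are nonnegative for the form `Im ⟨a, b⟩`. -/
theorem IsAdmissible.im_inner_nonneg {z : ℂ} (hz : 0 < z.im)
    {β : Matrix (Fin m) (Fin m ⊕ Fin m) ℂ} (hβ : IsAdmissible z β) {w : Fin m ⊕ Fin m → ℂ}
    (hw : β *ᵥ w = 0) :
    0 ≤ (inner ℂ (WithLp.toLp 2 (w ∘ Sum.inl) : EuclideanSpace ℂ (Fin m))
      (WithLp.toLp 2 (w ∘ Sum.inr))).im := by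
  refine im_inner_nonneg_of_boundary (Matrix.toEuclideanCLM (𝕜 := ℂ) β.toCols₁)
    (Matrix.toEuclideanCLM (𝕜 := ℂ) β.toCols₂) (fun u => ?_) (fun u h1 h2 => ?_) ?_
  · have h : inner ℂ (ContinuousLinearMap.adjoint (Matrix.toEuclideanCLM (𝕜 := ℂ) β.toCols₂) u)
        (ContinuousLinearMap.adjoint (Matrix.toEuclideanCLM (𝕜 := ℂ) β.toCols₁) u) =
        inner ℂ u (Matrix.toEuclideanCLM (𝕜 := ℂ) (β.toCols₂ * β.toCols₁ᴴ) u) := by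
      rw [ContinuousLinearMap.adjoint_inner_left, adjoint_toEuclideanCLM, map_mul]
      rfl
    rw [h]
    have h2 := inner_matIm (β.toCols₂ * β.toCols₁ᴴ) u
    rcases hβ.2 with h0 | h0
    · rw [h0, map_zero, zero_apply, inner_zero_right] at h2
      exact (Complex.ofReal_eq_zero.1 h2.symm).ge
    · have h3 := h0.posSemidef.dotProduct_mulVec_nonneg u.ofLp
      have h4 : star u.ofLp ⬝ᵥ (z.im • matIm (β.toCols₂ * β.toCols₁ᴴ)) *ᵥ u.ofLp =
          ((z.im * (inner ℂ u (Matrix.toEuclideanCLM (𝕜 := ℂ)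
            (β.toCols₂ * β.toCols₁ᴴ) u)).im : ℝ) : ℂ) := by
        rw [Complex.ofReal_mul, ← h2, EuclideanSpace.inner_eq_star_dotProduct,
          Matrix.ofLp_toEuclideanCLM, Matrix.smul_mulVec, dotProduct_smul, dotProduct_comm,
          Complex.real_smul]
      rw [h4] at h3
      exact nonneg_of_mul_nonneg_right (Complex.zero_le_real.1 h3) hz
  · rw [adjoint_toEuclideanCLM] at h1 h2
    have h3 : βᴴ *ᵥ u.ofLp = 0 := by
      ext i
      rcases i with i | i
      · exact congrFun (congrArg WithLp.ofLp h1) i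
      · exact congrFun (congrArg WithLp.ofLp h2) i
    have h4 := LinearMap.finrank_range_add_finrank_ker βᴴ.mulVecLin
    have h5 : Module.finrank ℂ (LinearMap.range βᴴ.mulVecLin) = m := by
      have := Matrix.rank_conjTranspose β
      rw [hβ.1] at this
      exact this
    rw [h5, Module.finrank_fintype_fun_eq_card, Fintype.card_fin, add_eq_left,
      Submodule.finrank_eq_zero, LinearMap.ker_eq_bot'] at h4
    exact WithLp.ofLp_injective 2 (h4 u.ofLp h3)
  · apply WithLp.ofLp_injective 2
    rw [WithLp.ofLp_add, Matrix.ofLp_toEuclideanCLM, Matrix.ofLp_toEuclideanCLM, WithLp.ofLp_zero,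
      ← hw]
    conv_rhs => rw [← Matrix.fromCols_toCols β, Matrix.fromCols_mulVec]

/-- The two blocks of `Ψ w` are a solution and its derivative, with forcing term `Q y`; the sum of
the absolute values of the entries serves as the bound for `‖Q‖`. -/
theorem IsFundamentalMatrix.isForcedSolution {Q : ℝ → Matrix (Fin m) (Fin m) ℂ} {x₀ c : ℝ}
    (hQ : IsPotential Q x₀) (hc : x₀ < c) {k : ℂ}
    {Ψ : ℝ → Matrix (Fin m ⊕ Fin m) (Fin m ⊕ Fin m) ℂ}
    (hΨ : IsFundamentalMatrix Q (k ^ 2) x₀ Ψ) (w : Fin m ⊕ Fin m → ℂ) :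
    IsForcedSolution (E := EuclideanSpace ℂ (Fin m))
      (fun x => WithLp.toLp 2 ((Ψ x *ᵥ w) ∘ Sum.inl))
      (fun x => WithLp.toLp 2 ((Ψ x *ᵥ w) ∘ Sum.inr))
      (fun x => WithLp.toLp 2 (Q x *ᵥ ((Ψ x *ᵥ w) ∘ Sum.inl)))
      (fun x => ∑ i, ∑ j, ‖Q x i j‖) k x₀ c := by
  have hac : ∀ i, AbsolutelyContinuousOnInterval (fun x => (Ψ x *ᵥ w) i) x₀ c := by
    intro i
    have h := AbsolutelyContinuousOnInterval.finset_sum Finset.univ fun j _ =>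
      (hΨ.absolutelyContinuous c hc i j).const_smul (w j)
    simp only [smul_eq_mul] at h
    simpa only [Matrix.mulVec, dotProduct, mul_comm (w _)] using h
  refine ⟨EuclideanSpace.absolutelyContinuousOnInterval fun i => hac (Sum.inl i),
    EuclideanSpace.absolutelyContinuousOnInterval fun i => hac (Sum.inr i), ?_,
    fun x => by positivity, ?_⟩
  · have h : ∀ i j, IntervalIntegrable (fun x => ‖Q x i j‖) volume x₀ c := fun i j => by
      rw [intervalIntegrable_iff_integrableOn_Ioc_of_le hc.le]
      exact ((hQ.integrable c hc i j).mono_set Ioc_subset_Icc_self).norm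
    have hrow : ∀ i, IntervalIntegrable (fun x => ∑ j, ‖Q x i j‖) volume x₀ c := fun i => by
      have := IntervalIntegrable.sum Finset.univ fun j _ => h i j
      rwa [Finset.sum_fn] at this
    have := IntervalIntegrable.sum Finset.univ fun i _ => hrow i
    rwa [Finset.sum_fn] at this
  · have h := hΨ.equation
    rw [ae_restrict_iff' measurableSet_Ioi] at h
    filter_upwards [h] with x hx hxm
    obtain ⟨Ψ', hd, he⟩ := hx hxm.1
    have hw : ∀ i, HasDerivAt (fun t => (Ψ t *ᵥ w) i) ((Ψ' *ᵥ w) i) x := by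
      intro i
      simp only [Matrix.mulVec, dotProduct]
      exact HasDerivAt.fun_sum fun j _ => (hd i j).mul_const (w j)
    have he' := congrArg (· *ᵥ w) he
    simp only [← Matrix.mulVec_mulVec] at he'
    have hJ : J m *ᵥ (Ψ' *ᵥ w) =
        Sum.elim (-((Ψ' *ᵥ w) ∘ Sum.inr)) ((Ψ' *ᵥ w) ∘ Sum.inl) := by
      rw [J, Matrix.fromBlocks_mulVec]
      simp [Matrix.neg_mulVec]
    have hB : (k ^ 2 • A m + B Q x) *ᵥ (Ψ x *ᵥ w) =
        Sum.elim (k ^ 2 • ((Ψ x *ᵥ w) ∘ Sum.inl) - Q x *ᵥ ((Ψ x *ᵥ w) ∘ Sum.inl))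
          ((Ψ x *ᵥ w) ∘ Sum.inr) := by
      rw [A, B, Matrix.fromBlocks_smul, Matrix.fromBlocks_add, Matrix.fromBlocks_mulVec]
      simp [Matrix.add_mulVec, Matrix.neg_mulVec, Matrix.smul_mulVec, sub_eq_add_neg]
    rw [hJ, hB] at he'
    have h1 : (Ψ' *ᵥ w) ∘ Sum.inl = (Ψ x *ᵥ w) ∘ Sum.inr := by
      have := congrArg (· ∘ Sum.inr) he'
      simpa using this
    have h2 : (Ψ' *ᵥ w) ∘ Sum.inr =
        Q x *ᵥ ((Ψ x *ᵥ w) ∘ Sum.inl) - k ^ 2 • ((Ψ x *ᵥ w) ∘ Sum.inl) := by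
      have := congrArg (fun f => -(f ∘ Sum.inl)) he'
      simpa using this
    refine ⟨EuclideanSpace.hasDerivAt_of_forall fun i => ?_,
      EuclideanSpace.hasDerivAt_of_forall fun i => ?_,
      EuclideanSpace.norm_toLp_mulVec_le (Q x) (WithLp.toLp 2 ((Ψ x *ᵥ w) ∘ Sum.inl))⟩
    · have h3 := congrFun h1 i
      rw [Function.comp_apply, Function.comp_apply] at h3
      have h4 := hw (Sum.inl i)
      rw [h3] at h4
      exact h4
    · have h3 := congrFun h2 i
      rw [Function.comp_apply] at h3
      have h4 := hw (Sum.inr i)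
      rw [h3] at h4
      exact h4

/-- Quantitative form of the asymptotics on the whole Weyl disk at a finite endpoint `c`. Since the
bound is closed in `M`, no uniqueness of the fundamental matrix is needed to pass to the closure. -/
theorem norm_sub_le_of_mem_closure_weylSet {Q : ℝ → Matrix (Fin m) (Fin m) ℂ} {x₀ c : ℝ}
    (hQ : IsPotential Q x₀) (hc : x₀ < c) {k : ℂ} {ρ δ : ℝ} (hρ : 0 < ρ) (hk : 0 < ‖k‖)
    (hre : ρ * ‖k‖ ≤ k.re) (him : ρ * ‖k‖ ≤ k.im)
    (hδ : 2 * (Real.exp (-(ρ * ‖k‖ * (c - x₀))) * (1 + 2 / ρ) +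
      (1 + 1 / ρ) / ‖k‖ * ∫ x in x₀..c, ∑ i, ∑ j, ‖Q x i j‖) ≤ δ) (hδ₂ : δ ≤ 1 / 2)
    {M : Matrix (Fin m) (Fin m) ℂ} (hM : M ∈ closure (weylSet Q (k ^ 2) c x₀)) :
    ‖M - (Complex.I * k) • (1 : Matrix (Fin m) (Fin m) ℂ)‖ ≤ 4 * δ * ‖k‖ := by
  have hkre : 0 < k.re := lt_of_lt_of_le (by positivity) hre
  have hkim : 0 < k.im := lt_of_lt_of_le (by positivity) him
  have hz : 0 < (k ^ 2).im := by
    rw [sq, Complex.mul_im]; positivity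
  have hI : 0 ≤ ∫ x in x₀..c, ∑ i, ∑ j, ‖Q x i j‖ :=
    intervalIntegral.integral_nonneg hc.le fun x _ => by positivity
  have hexp : 0 ≤ Real.exp (-(ρ * ‖k‖ * (c - x₀))) * (1 + 2 / ρ) := by positivity
  have hκ : 0 ≤ (1 + 1 / ρ) / ‖k‖ * ∫ x in x₀..c, ∑ i, ∑ j, ‖Q x i j‖ := by positivity
  have hδ0 : 0 ≤ δ := by linarith
  suffices hsub : closure (weylSet Q (k ^ 2) c x₀) ⊆
      {M | ‖M - (Complex.I * k) • (1 : Matrix (Fin m) (Fin m) ℂ)‖ ≤ 4 * δ * ‖k‖} from hsub hM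
  refine closure_minimal ?_ (isClosed_le (by fun_prop) continuous_const)
  clear hM M
  rintro M ⟨Ψ, hΨ, β, hβ, hu, hMeq⟩
  rw [mem_ofPred_eq, Matrix.cstar_norm_def]
  refine ContinuousLinearMap.opNorm_le_bound _ (by positivity) fun v => ?_
  set w : Fin m ⊕ Fin m → ℂ := Sum.elim v.ofLp (M *ᵥ v.ofLp) with hw
  have H := hΨ.isForcedSolution hQ hc w
  have hend : β *ᵥ (Ψ c *ᵥ w) = 0 := by
    have h1 : β * (Ψ c).toCols₂ * M = -(β * (Ψ c).toCols₁) := by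
      have hdet := (Matrix.isUnit_iff_isUnit_det _).1 hu
      rw [hMeq, mul_neg, ← Matrix.mul_assoc, Matrix.mul_nonsing_inv _ hdet, Matrix.one_mul]
    have h2 : Ψ c *ᵥ w = (Ψ c).toCols₁ *ᵥ v.ofLp + (Ψ c).toCols₂ *ᵥ (M *ᵥ v.ofLp) := by
      conv_lhs => rw [← Matrix.fromCols_toCols (Ψ c), Matrix.fromCols_mulVec]
      simp [hw]
    rw [h2, Matrix.mulVec_add, Matrix.mulVec_mulVec, Matrix.mulVec_mulVec, Matrix.mulVec_mulVec,
      h1, Matrix.neg_mulVec, add_neg_cancel]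
  have hendpos := hβ.im_inner_nonneg hz hend
  have hherm : ∀ᵐ x, x ∈ Ioc x₀ c →
      (inner ℂ (WithLp.toLp 2 ((Ψ x *ᵥ w) ∘ Sum.inl) : EuclideanSpace ℂ (Fin m))
        (WithLp.toLp 2 (Q x *ᵥ ((Ψ x *ᵥ w) ∘ Sum.inl)))).im = 0 := by
    have h := hQ.selfAdjoint
    rw [ae_restrict_iff' measurableSet_Ici] at h
    filter_upwards [h] with x hx hxm
    have h1 := inner_matIm (Q x) (WithLp.toLp 2 ((Ψ x *ᵥ w) ∘ Sum.inl))
    rw [matIm, hx hxm.1.le, sub_self, smul_zero, map_zero, zero_apply,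
      inner_zero_right] at h1
    exact Complex.ofReal_eq_zero.1 h1.symm
  have hpos : ∀ x ∈ Icc x₀ c,
      0 ≤ (inner ℂ (WithLp.toLp 2 ((Ψ x *ᵥ w) ∘ Sum.inl) : EuclideanSpace ℂ (Fin m))
        (WithLp.toLp 2 ((Ψ x *ᵥ w) ∘ Sum.inr))).im := by
    intro x hx
    refine hendpos.trans ((H.mono hx.1 hx.2 le_rfl).im_inner_anti hx.2 hz.le ?_)
    filter_upwards [hherm] with t ht htm
    exact ht (Ioc_subset_Ioc_left hx.1 htm)
  have key := H.norm_sub_le_mul_norm_add hc.le hρ hk hre him hpos (by linarith)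
  have hw1 : (WithLp.toLp 2 ((Ψ x₀ *ᵥ w) ∘ Sum.inl) : EuclideanSpace ℂ (Fin m)) = v := by
    rw [hΨ.initial, Matrix.one_mulVec]; rfl
  have hw2 : (WithLp.toLp 2 ((Ψ x₀ *ᵥ w) ∘ Sum.inr) : EuclideanSpace ℂ (Fin m)) =
      Matrix.toEuclideanCLM (𝕜 := ℂ) M v := by
    rw [hΨ.initial, Matrix.one_mulVec]; rfl
  simp only [hw1, hw2] at key
  rw [map_sub, map_smul, map_one, sub_apply, smul_apply,
    one_apply_eq_self]
  set r := Matrix.toEuclideanCLM (𝕜 := ℂ) M v - (Complex.I * k) • v with hr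
  have hs : ‖Matrix.toEuclideanCLM (𝕜 := ℂ) M v + (Complex.I * k) • v‖ ≤
      ‖r‖ + 2 * ‖k‖ * ‖v‖ := by
    have : Matrix.toEuclideanCLM (𝕜 := ℂ) M v + (Complex.I * k) • v =
        r + (2 * (Complex.I * k)) • v := by rw [hr]; module
    rw [this]
    refine (norm_add_le _ _).trans_eq ?_
    rw [norm_smul]
    simp
  have h3 : ‖r‖ ≤ δ * (‖r‖ + 2 * ‖k‖ * ‖v‖) := key.trans (by gcongr)
  -- With `δ ≤ 1 / 2` the term `δ ‖r‖` can be absorbed on the left.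
  have h4 : δ * ‖r‖ ≤ 1 / 2 * ‖r‖ := by gcongr
  linarith

/-- Square roots of points of the sector stay in a closed sector inside the open first quadrant. -/
theorem exists_sector_bound {ε : ℝ} (hε₁ : ε < Real.pi) :
    ∃ ρ : ℝ, 0 < ρ ∧ ∀ z ∈ sector ε, ‖z ^ (1 / 2 : ℂ)‖ = ‖z‖ ^ (1 / 2 : ℝ) ∧
      ρ * ‖z ^ (1 / 2 : ℂ)‖ ≤ (z ^ (1 / 2 : ℂ)).re ∧
      ρ * ‖z ^ (1 / 2 : ℂ)‖ ≤ (z ^ (1 / 2 : ℂ)).im := by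
  rcases le_or_gt ε 0 with hε₀ | hε₀
  · refine ⟨1, one_pos, fun z hz => ?_⟩
    have := hz.2
    have := abs_nonneg (z.arg - Real.pi / 2)
    linarith
  have hpi := Real.pi_pos
  refine ⟨Real.cos (Real.pi / 4 + ε / 4), Real.cos_pos_of_mem_Ioo ⟨by linarith, by linarith⟩,
    fun z hz => ?_⟩
  have hz0 : z ≠ 0 := by
    rintro rfl
    simpa using hz.1
  obtain ⟨h1, h2⟩ := abs_lt.1 hz.2
  have hk : z ^ (1 / 2 : ℂ) = ((‖z‖ ^ (1 / 2 : ℝ) : ℝ) : ℂ) *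
      (Real.cos (z.arg / 2) + Real.sin (z.arg / 2) * Complex.I) := by
    have h3 := Complex.cpow_def_of_ne_zero hz0 (1 / 2)
    have h4 : Complex.log z * (1 / 2) =
        ((Real.log ‖z‖ * (1 / 2) : ℝ) : ℂ) + ((z.arg / 2 : ℝ) : ℂ) * Complex.I := by
      rw [Complex.log]; push_cast; ring
    rw [h3, h4, Complex.exp_add, Complex.exp_mul_I, ← Complex.ofReal_exp,
      Real.rpow_def_of_pos (norm_pos_iff.2 hz0), Complex.ofReal_cos, Complex.ofReal_sin]
  have hnorm : ‖z ^ (1 / 2 : ℂ)‖ = ‖z‖ ^ (1 / 2 : ℝ) := by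
    rw [show (1 / 2 : ℂ) = ((1 / 2 : ℝ) : ℂ) by push_cast; rfl, Complex.norm_cpow_real]
  have hre : (z ^ (1 / 2 : ℂ)).re = ‖z‖ ^ (1 / 2 : ℝ) * Real.cos (z.arg / 2) := by
    rw [hk, Complex.re_ofReal_mul, Complex.add_re, Complex.ofReal_re, Complex.re_ofReal_mul]; simp
  have him : (z ^ (1 / 2 : ℂ)).im = ‖z‖ ^ (1 / 2 : ℝ) * Real.sin (z.arg / 2) := by
    rw [hk, Complex.im_ofReal_mul, Complex.add_im, Complex.ofReal_im, Complex.im_ofReal_mul]; simp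
  rw [hnorm, hre, him]
  have h0 : 0 ≤ ‖z‖ ^ (1 / 2 : ℝ) := by positivity
  refine ⟨rfl, ?_, ?_⟩ <;> rw [mul_comm] <;> refine mul_le_mul_of_nonneg_left ?_ h0
  · exact Real.cos_le_cos_of_nonneg_of_le_pi (by linarith) (by linarith) (by linarith)
  · rw [← Real.cos_pi_div_two_sub]
    exact Real.cos_le_cos_of_nonneg_of_le_pi (by linarith) (by linarith) (by linarith)

end WeylTitchmarsh

theorem theorem3p1 {m : ℕ} (Q : ℝ → Matrix (Fin m) (Fin m) ℂ) (x₀ : ℝ)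
    (hQ : WeylTitchmarsh.IsPotential Q x₀)
    (ε : ℝ) (hε₀ : 0 < ε) (hε₁ : ε < Real.pi)
    (M : ℂ → Matrix (Fin m) (Fin m) ℂ)
    (hM : ∀ z ∈ WeylTitchmarsh.sector ε, M z ∈ WeylTitchmarsh.limitDisk Q z x₀) :
    Asymptotics.IsLittleO (Bornology.cobounded ℂ ⊓ Filter.principal (WeylTitchmarsh.sector ε))
      (fun z : ℂ => M z - (Complex.I * z ^ (1 / 2 : ℂ)) • (1 : Matrix (Fin m) (Fin m) ℂ))
      (fun z : ℂ => ‖z‖ ^ (1 / 2 : ℝ)) := by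
  obtain ⟨ρ, hρ, hsec⟩ := WeylTitchmarsh.exists_sector_bound hε₁
  set I := ∫ x in x₀..x₀ + 1, ∑ i, ∑ j, ‖Q x i j‖
  have hlim : Tendsto (fun t : ℝ => 2 * (Real.exp (-(ρ * t * (x₀ + 1 - x₀))) * (1 + 2 / ρ) +
      (1 + 1 / ρ) / t * I)) atTop (nhds 0) := by
    have h1 : Tendsto (fun t : ℝ => Real.exp (-(ρ * t * (x₀ + 1 - x₀)))) atTop (nhds 0) := by
      refine Real.tendsto_exp_neg_atTop_nhds_zero.comp ?_
      simpa using tendsto_id.const_mul_atTop hρ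
    have h2 : Tendsto (fun t : ℝ => (1 + 1 / ρ) / t) atTop (nhds 0) :=
      tendsto_const_nhds.div_atTop tendsto_id
    simpa using ((h1.mul_const (1 + 2 / ρ)).add (h2.mul_const I)).const_mul 2
  have hroot : Tendsto (fun z : ℂ => ‖z‖ ^ (1 / 2 : ℝ)) (Bornology.cobounded ℂ) atTop :=
    (tendsto_rpow_atTop (by norm_num)).comp tendsto_norm_cobounded_atTop
  rw [Asymptotics.isLittleO_iff]
  intro η hη
  have hev := hroot.eventually ((hlim.eventually_le_const
    (show (0 : ℝ) < min (η / 4) (1 / 2) by positivity)).and (eventually_gt_atTop 0))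
  rw [eventually_inf_principal]
  filter_upwards [hev] with z hz hzs
  obtain ⟨hnorm, hre, him⟩ := hsec z hzs
  rw [← hnorm] at hz
  have hsq : (z ^ (1 / 2 : ℂ)) ^ 2 = z := by
    rw [one_div]; exact Complex.cpow_ofNat_inv_pow z 2
  have hmem : M z ∈ closure (WeylTitchmarsh.weylSet Q ((z ^ (1 / 2 : ℂ)) ^ 2) (x₀ + 1) x₀) := by
    rw [hsq]
    exact mem_iInter₂.1 (hM z hzs) (x₀ + 1) (by simp)
  refine (WeylTitchmarsh.norm_sub_le_of_mem_closure_weylSet hQ (by linarith) hρ hz.2 hre him hz.1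
    (min_le_right _ _) hmem).trans ?_
  rw [← hnorm, norm_norm]
  have := min_le_left (η / 4) (1 / 2)
  gcongr
  linarith
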